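/- A hypergraph $\mathcal H=(V,H)$ consists of a nonempty (possibly infinite) vertex set $V$ and a collection $H$ of subsets of $V$, called hyperedges. Its theta complex $\Theta(\mathcal H)$ is the simplicial complex whose simplices are the nonempty finite subsets of complements $V\setminus h$ of hyperedges $h\in H$. A simplicial complex is identified with its geometric realization (with the weak topology). The join $K*L$ of two simplicial complexes on disjoint vertex sets is the complex whose simplices are the nonempty unions $\sigma\cup\tau$, where $\sigma$ is empty or a simplex of $K$ and $\tau$ is empty or a simplex of $L$; the suspension $\Sigma K$ is the join of $K$ with two points (so $\emptyset*K=K$, and $\Sigma\emptyset$ is two points). (1) Let $\mathcal H_1$ and $\mathcal H_2$ be hypergraphs, each with at least one hyperedge, and let $\mathcal H_1\coprod\mathcal H_2$ be their disjoint union. Then there is a homotopy equivalence $$\Theta\left(\mathcal H_1\coprod\mathcal H_2\right)\simeq\Sigma\left(\Theta(\mathcal H_1)*\Theta(\mathcal H_2)\right).$$ (2) Let $\mathcal H$ be a hypergraph with at least one hyperedge and with an isolated vertex, that is, a vertex contained in no hyperedge. Then $\Theta(\mathcal H)$ is contractible. -/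

import Mathlib

open scoped ContinuousMap

namespace PreAbstractSimplicialComplex

variable {α β : Type*}

/-- The (simplicial) join `K * L`: its simplices are the nonempty disjoint unions `σ ⊔ τ` with
`σ` empty or a simplex of `K`, and `τ` empty or a simplex of `L`. -/
def join (K : PreAbstractSimplicialComplex α) (L : PreAbstractSimplicialComplex β) :
    PreAbstractSimplicialComplex (α ⊕ β) where
  faces := {s | s.Nonempty ∧ (s.toLeft = ∅ ∨ s.toLeft ∈ K.faces) ∧
    (s.toRight = ∅ ∨ s.toRight ∈ L.faces)}
  isRelLowerSet_faces := by
    rintro s ⟨hs, hl, hr⟩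
    refine ⟨hs, fun t hts ht => ⟨ht, ?_, ?_⟩⟩
    · have h : t.toLeft ⊆ s.toLeft := Finset.toLeft_subset_toLeft hts
      rcases t.toLeft.eq_empty_or_nonempty with h0 | h0
      · exact Or.inl h0
      · rcases hl with hl | hl
        · exact Or.inl (Finset.subset_empty.1 (hl ▸ h))
        · exact Or.inr ((K.isRelLowerSet_faces hl).2 h h0)
    · have h : t.toRight ⊆ s.toRight := Finset.toRight_subset_toRight hts
      rcases t.toRight.eq_empty_or_nonempty with h0 | h0
      · exact Or.inl h0
      · rcases hr with hr | hr
        · exact Or.inl (Finset.subset_empty.1 (hr ▸ h))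
        · exact Or.inr ((L.isRelLowerSet_faces hr).2 h h0)

/-- The zero-sphere: two vertices and no edge between them. -/
def twoPoints : PreAbstractSimplicialComplex Bool where
  faces := {s | ∃ b, s = {b}}
  isRelLowerSet_faces := by
    rintro s ⟨b, rfl⟩
    refine ⟨Finset.singleton_nonempty b, fun t hts ht => ⟨b, ?_⟩⟩
    exact (Finset.subset_singleton_iff.1 hts).resolve_left ht.ne_empty

/-- The (unreduced) suspension `Σ K`: the union of two cones over `K`, that is, the join of `K`
with the zero-sphere. In particular the suspension of the empty complex is the zero-sphere. -/
def suspension (K : PreAbstractSimplicialComplex α) : PreAbstractSimplicialComplex (α ⊕ Bool) :=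
  K.join twoPoints

/-- The geometric realization of `K` as a set: finitely supported barycentric coordinates whose
support is a simplex of `K`. -/
def Realization (K : PreAbstractSimplicialComplex α) : Type _ :=
  {x : α →₀ ℝ // (∀ a, 0 ≤ x a) ∧ (x.sum fun _ r => r) = 1 ∧ x.support ∈ K.faces}

namespace Realization

/-- The closed simplex of the realization that is spanned by the finite set `s`. -/
def ClosedSimplex (K : PreAbstractSimplicialComplex α) (s : Finset α) : Type _ :=
  {x : K.Realization // x.1.support ⊆ s}

/-- A closed simplex carries its Euclidean topology, that of the barycentric coordinates. -/
instance (K : PreAbstractSimplicialComplex α) (s : Finset α) :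
    TopologicalSpace (ClosedSimplex K s) :=
  TopologicalSpace.induced (fun x (a : α) => x.1.1 a) inferInstance

/-- The weak topology: a set is open if and only if its intersection with every closed simplex
is open in that simplex. -/
instance (K : PreAbstractSimplicialComplex α) : TopologicalSpace K.Realization :=
  ⨆ s : K.faces, TopologicalSpace.coinduced
    (fun x : ClosedSimplex K s.1 => x.1) inferInstance

end Realization

end PreAbstractSimplicialComplex

namespace Hypergraph

variable {α β : Type*}

/-- The disjoint union of two hypergraphs. -/
def disjUnion (H₁ : Hypergraph α) (H₂ : Hypergraph β) : Hypergraph (α ⊕ β) where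
  vertexSet := Sum.inl '' H₁.vertexSet ∪ Sum.inr '' H₂.vertexSet
  edgeSet := (Set.image Sum.inl) '' H₁.edgeSet ∪ (Set.image Sum.inr) '' H₂.edgeSet
  subset_vertexSet_of_mem_edgeSet' := by
    rintro _ (⟨e, he, rfl⟩ | ⟨e, he, rfl⟩)
    · exact (Set.image_mono (H₁.subset_vertexSet_of_mem_edgeSet' he)).trans
        Set.subset_union_left
    · exact (Set.image_mono (H₂.subset_vertexSet_of_mem_edgeSet' he)).trans
        Set.subset_union_right

/-- The theta complex: its simplices are the nonempty finite subsets of complements (in the vertex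
set) of hyperedges. -/
def theta (H : Hypergraph α) : PreAbstractSimplicialComplex α where
  faces := {s | s.Nonempty ∧ ∃ e ∈ H.edgeSet, (s : Set α) ⊆ H.vertexSet \ e}
  isRelLowerSet_faces := by
    rintro s ⟨hs, e, he, hse⟩
    exact ⟨hs, fun t hts ht => ⟨ht, e, he, (Finset.coe_subset.2 hts).trans hse⟩⟩

end Hypergraph

/-! Let `K`, `L` be the theta complexes and `A`, `B` the vertex sets of the two hypergraphs. The
complement of a hyperedge of the first is enlarged by all of `B`, and symmetrically. So the theta
complex of the disjoint union is `U = K * Δ_B ∪ Δ_A * L`, with `Δ` a full simplex. Both pieces are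
contractible and meet in `K * L`, so `U ≃ Σ(K * L)`.

The proof makes this explicit with unnormalized barycentric weights. The depth of a weight measures
how far it is from being supported on a simplex; subtracting it and cutting off at zero leaves a
simplex or nothing (`support_truncate`). `spread : U → Σ(K * L)` truncates both components and
records the two depths at the poles. One depth vanishes on `U`, so the two poles are never both
used. `collapse` goes back, moving the pole weights to fixed vertices `a ∈ A` and `b ∈ B`. The
composites are joined to the identities by explicit families of weights
(`isWeight_add_collapse_spread`, `isWeight_spread_add_poles`).

For part (2), an isolated vertex lies in the complement of every hyperedge, so it is a cone point.
-/

open unitInterval Topology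

/-! ### Coordinatewise continuous families of weights -/

/-- A family of finitely supported functions is coordinatewise continuous if each coordinate is
continuous and the supports all lie in one finite set. -/
def Finsupp.CoordContinuous {X α : Type*} [TopologicalSpace X] (w : X → α →₀ ℝ) : Prop :=
  (∃ T : Finset α, ∀ x, (w x).support ⊆ T) ∧ ∀ a, Continuous fun x => w x a

namespace Finsupp.CoordContinuous

variable {X α β : Type*} [TopologicalSpace X] {w w' : X → α →₀ ℝ}

theorem const (v : α →₀ ℝ) : CoordContinuous fun _ : X => v :=
  ⟨⟨v.support, fun _ => subset_rfl⟩, fun _ => continuous_const⟩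

theorem single (a : α) {r : X → ℝ} (hr : Continuous r) :
    CoordContinuous fun x => Finsupp.single a (r x) := by
  classical
  refine ⟨⟨{a}, fun x => Finsupp.support_single_subset⟩, fun b => ?_⟩
  by_cases h : a = b
  · subst h; simpa using hr
  · simpa [Finsupp.single_apply, h] using continuous_const

theorem add (hw : CoordContinuous w) (hw' : CoordContinuous w') :
    CoordContinuous fun x => w x + w' x := by
  classical
  obtain ⟨⟨T, hT⟩, hc⟩ := hw
  obtain ⟨⟨T', hT'⟩, hc'⟩ := hw'
  exact ⟨⟨T ∪ T', fun x => Finsupp.support_add.trans (Finset.union_subset_union (hT x) (hT' x))⟩,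
    fun a => (hc a).add (hc' a)⟩

theorem smul {r : X → ℝ} (hr : Continuous r) (hw : CoordContinuous w) :
    CoordContinuous fun x => r x • w x := by
  obtain ⟨⟨T, hT⟩, hc⟩ := hw
  exact ⟨⟨T, fun x => Finsupp.support_smul.trans (hT x)⟩, fun a => hr.mul (hc a)⟩

theorem comapDomain {f : β → α} (hf : f.Injective) (hw : CoordContinuous w) :
    CoordContinuous fun x => (w x).comapDomain f hf.injOn := by
  obtain ⟨⟨T, hT⟩, hc⟩ := hw
  refine ⟨⟨T.preimage f hf.injOn, fun x b hb => ?_⟩, fun b => hc (f b)⟩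
  rw [Finset.mem_preimage]
  exact hT x (by simpa using hb)

theorem sumElim {v : X → β →₀ ℝ} (hw : CoordContinuous w) (hv : CoordContinuous v) :
    CoordContinuous fun x => (w x).sumElim (v x) := by
  obtain ⟨⟨T, hT⟩, hc⟩ := hw
  obtain ⟨⟨S, hS⟩, hd⟩ := hv
  refine ⟨⟨T.disjSum S, fun x => ?_⟩, ?_⟩
  · rintro (a | b) h
    · exact Finset.inl_mem_disjSum.2 (hT x (by simpa using h))
    · exact Finset.inr_mem_disjSum.2 (hS x (by simpa using h))
  · rintro (a | b)
    · exact hc a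
    · exact hd b

theorem sum (hw : CoordContinuous w) : Continuous fun x => (w x).sum fun _ r => r := by
  obtain ⟨⟨T, hT⟩, hc⟩ := hw
  have : (fun x => (w x).sum fun _ r => r) = fun x => ∑ a ∈ T, w x a := by
    funext x
    exact Finsupp.sum_of_support_subset _ (hT x) _ (by simp)
  rw [this]
  exact continuous_finsetSum _ fun a _ => hc a

theorem comp {Y : Type*} [TopologicalSpace Y] {f : Y → X} (hw : CoordContinuous w)
    (hf : Continuous f) : CoordContinuous fun y => w (f y) :=
  ⟨hw.1.imp fun _ h y => h (f y), fun a => (hw.2 a).comp hf⟩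

end Finsupp.CoordContinuous

/-! ### Continuous maps and homotopies for the weak topology -/

namespace PreAbstractSimplicialComplex

variable {α β X : Type*} [TopologicalSpace X]
  {K : PreAbstractSimplicialComplex α} {L : PreAbstractSimplicialComplex β}

theorem mem_faces_of_subset {s t : Finset α} (hs : s ∈ K.faces) (hts : t ⊆ s) (ht : t.Nonempty) :
    t ∈ K.faces :=
  (K.isRelLowerSet_faces hs).2 hts ht

namespace Realization

theorem continuous_closedSimplex_val {s : Finset α} (hs : s ∈ K.faces) :
    Continuous fun x : ClosedSimplex K s => x.1 := by
  rw [continuous_iff_coinduced_le]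
  exact le_iSup (fun s : K.faces => TopologicalSpace.coinduced
    (fun x : ClosedSimplex K s.1 => x.1) inferInstance) ⟨s, hs⟩

theorem isInducing_coe (s : Finset α) :
    IsInducing fun (x : ClosedSimplex K s) (a : α) => x.1.1 a := ⟨rfl⟩

theorem coordContinuous_closedSimplex (s : Finset α) :
    Finsupp.CoordContinuous fun x : ClosedSimplex K s => x.1.1 :=
  ⟨⟨s, fun x => x.2⟩, fun a => (continuous_apply a).comp (isInducing_coe s).continuous⟩

/-- A map out of a realization is continuous if it is so on every closed simplex. -/
theorem continuous_of_closedSimplex {f : K.Realization → X}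
    (hf : ∀ s ∈ K.faces, Continuous fun x : ClosedSimplex K s => f x.1) : Continuous f := by
  rw [continuous_iSup_dom]
  rintro ⟨s, hs⟩
  rw [continuous_coinduced_dom]
  exact hf s hs

/-- The same for maps depending on a parameter in the unit interval. -/
theorem continuous_prod_of_closedSimplex {f : I × K.Realization → X}
    (hf : ∀ s ∈ K.faces, Continuous fun z : I × ClosedSimplex K s => f (z.1, z.2.1)) :
    Continuous f := by
  have hc : ∀ x : K.Realization, Continuous fun u : I => f (u, x) := fun x =>
    let x' : ClosedSimplex K x.1.support := ⟨x, Finset.Subset.refl _⟩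
    (hf _ x.2.2.2).comp (Continuous.prodMk_left x')
  -- Currying reduces to a map out of the realization alone; uncurrying is continuous because `I` is
  -- locally compact.
  let F : K.Realization → C(I, X) := fun x => ⟨fun u => f (u, x), hc x⟩
  have hF : Continuous F := continuous_of_closedSimplex fun s hs =>
    ContinuousMap.continuous_of_continuous_uncurry _ ((hf s hs).comp continuous_swap)
  exact (ContinuousMap.continuous_uncurry_of_continuous ⟨F, hF⟩).comp continuous_swap

/-- Only finitely many simplices lie in the common finite set `T`. The closed sets on which `f`
lands in a given one of them cover `X`, and on each the target topology is that of the coordinates.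
-/
theorem continuous_of_coordContinuous {f : X → L.Realization}
    (hf : Finsupp.CoordContinuous fun x => (f x).1) : Continuous f := by
  classical
  obtain ⟨⟨T, hT⟩, hc⟩ := hf
  let A : {s // s ∈ T.powerset.filter (· ∈ L.faces)} → Set X := fun s => {x | (f x).1.support ⊆ s.1}
  have hA : ∀ s, A s = ⋂ a ∈ {a | a ∉ s.1}, {x | (f x).1 a = 0} := fun s => by
    ext x
    simp only [A, Set.mem_ofPred_eq, Set.mem_iInter, Finset.subset_iff, Finsupp.mem_support_iff]
    exact forall_congr' fun a => not_imp_comm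
  have hclosed : ∀ s, IsClosed (A s) := fun s => by
    rw [hA]
    exact isClosed_biInter fun a _ => isClosed_eq (hc a) continuous_const
  have hcover : ⋃ s, A s = Set.univ := Set.eq_univ_of_forall fun x =>
    Set.mem_iUnion.2 ⟨⟨(f x).1.support,
      Finset.mem_filter.2 ⟨Finset.mem_powerset.2 (hT x), (f x).2.2.2⟩⟩,
      Finset.Subset.refl (f x).1.support⟩
  refine (locallyFinite_of_finite A).continuous hcover hclosed fun s => ?_
  rw [continuousOn_iff_continuous_domRestrict]
  let g : A s → ClosedSimplex L s.1 := fun x => ⟨f x, x.2⟩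
  have hg : Continuous g := by
    rw [(isInducing_coe s.1).continuous_iff]
    exact continuous_pi fun a => (hc a).comp continuous_subtype_val
  exact (continuous_closedSimplex_val (Finset.mem_filter.1 s.2).2).comp hg

/-- Weights on the vertices whose support is a simplex: unnormalized barycentric coordinates. -/
structure _root_.PreAbstractSimplicialComplex.IsWeight (K : PreAbstractSimplicialComplex α)
    (w : α →₀ ℝ) : Prop where
  nonneg : ∀ a, 0 ≤ w a
  support_mem : w.support ∈ K.faces

theorem isWeight (x : K.Realization) : K.IsWeight x.1 := ⟨x.2.1, x.2.2.2⟩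

theorem _root_.PreAbstractSimplicialComplex.IsWeight.sum_pos {w : α →₀ ℝ} (hw : K.IsWeight w) :
    0 < w.sum fun _ r => r :=
  Finset.sum_pos (fun a ha => (hw.nonneg a).lt_of_ne' (Finsupp.mem_support_iff.1 ha))
    (K.isRelLowerSet_faces hw.support_mem).1

/-- The point of the realization with the given weights as barycentric coordinates, up to scale. -/
noncomputable def ofWeight (w : α →₀ ℝ) (hw : K.IsWeight w) : K.Realization :=
  ⟨(w.sum fun _ r => r)⁻¹ • w, fun a => mul_nonneg (inv_nonneg.2 hw.sum_pos.le) (hw.nonneg a), by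
    rw [Finsupp.sum_smul_index (fun _ => rfl)]
    simp only [Finsupp.sum, ← Finset.mul_sum]
    exact inv_mul_cancel₀ hw.sum_pos.ne', by
    rw [Finsupp.support_smul_eq (inv_ne_zero hw.sum_pos.ne')]
    exact hw.support_mem⟩

theorem ofWeight_eq {w : α →₀ ℝ} {x : K.Realization} (hw : K.IsWeight w) {c : ℝ} (hc : 0 < c)
    (h : w = c • x.1) : ofWeight w hw = x := by
  subst h
  apply Subtype.ext
  have hs : ((c • x.1).sum fun _ r => r) = c := by
    rw [Finsupp.sum_smul_index (fun _ => rfl)]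
    simp only [Finsupp.sum, ← Finset.mul_sum]
    exact (congrArg (c * ·) x.2.2.1).trans (mul_one c)
  change _ • (c • x.1) = x.1
  rw [hs, smul_smul, inv_mul_cancel₀ hc.ne', one_smul]

/-- A family of weights depending on a parameter gives a continuous map of realizations if it is
coordinatewise continuous on every closed simplex. -/
theorem continuous_ofWeight {w : I → (α →₀ ℝ) → β →₀ ℝ}
    (hw : ∀ (u : I) (x : K.Realization), L.IsWeight (w u x.1))
    (hc : ∀ s : Finset α, Finsupp.CoordContinuous fun z : I × ClosedSimplex K s => w z.1 z.2.1.1) :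
    Continuous fun z : I × K.Realization => ofWeight (w z.1 z.2.1) (hw z.1 z.2) :=
  continuous_prod_of_closedSimplex fun s _ => continuous_of_coordContinuous <|
    .smul ((hc s).sum.inv₀ fun z => (hw z.1 z.2.1).sum_pos.ne') (hc s)

/-- The map of realizations given by a family of weights. -/
noncomputable def mapOfWeight (w : (α →₀ ℝ) → β →₀ ℝ)
    (hw : ∀ x : K.Realization, L.IsWeight (w x.1))
    (hc : ∀ s : Finset α, Finsupp.CoordContinuous fun x : ClosedSimplex K s => w x.1.1) :
    C(K.Realization, L.Realization) :=
  ⟨fun x => ofWeight (w x.1) (hw x),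
    (continuous_ofWeight (fun _ => hw) fun s => (hc s).comp continuous_snd).comp
      (Continuous.prodMk_right (0 : I))⟩

/-- A family of weights depending on a parameter gives a homotopy. -/
theorem homotopic_of_weight {f g : C(K.Realization, L.Realization)} (w : I → (α →₀ ℝ) → β →₀ ℝ)
    (hw : ∀ (u : I) (x : K.Realization), L.IsWeight (w u x.1))
    (hc : ∀ s : Finset α, Finsupp.CoordContinuous fun z : I × ClosedSimplex K s => w z.1 z.2.1.1)
    (h₀ : ∀ x, ∃ c : ℝ, 0 < c ∧ w 0 x.1 = c • (f x).1)
    (h₁ : ∀ x, ∃ c : ℝ, 0 < c ∧ w 1 x.1 = c • (g x).1) : f.Homotopic g :=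
  ⟨⟨⟨_, continuous_ofWeight hw hc⟩,
    fun x => (h₀ x).elim fun _ h => ofWeight_eq (hw 0 x) h.1 h.2,
    fun x => (h₁ x).elim fun _ h => ofWeight_eq (hw 1 x) h.1 h.2⟩⟩

theorem coordContinuous_snd (s : Finset α) :
    Finsupp.CoordContinuous fun z : I × ClosedSimplex K s => z.2.1.1 :=
  (coordContinuous_closedSimplex s).comp continuous_snd

theorem smul_mapOfWeight {w : (α →₀ ℝ) → β →₀ ℝ}
    {hw : ∀ x : K.Realization, L.IsWeight (w x.1)}
    {hc : ∀ s : Finset α, Finsupp.CoordContinuous fun x : ClosedSimplex K s => w x.1.1}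
    (x : K.Realization) : ∃ c : ℝ, 0 < c ∧ w x.1 = c • (mapOfWeight w hw hc x).1 :=
  ⟨_, (hw x).sum_pos, by
    change _ = _ • (_⁻¹ • w x.1)
    rw [smul_smul, mul_inv_cancel₀ (hw x).sum_pos.ne', one_smul]⟩

end Realization

/-! ### Cones -/

/-- A complex with a vertex that can be added to every simplex is a cone. -/
theorem contractibleSpace_of_cone [DecidableEq α] {v : α} (hv : {v} ∈ K.faces)
    (h : ∀ s ∈ K.faces, insert v s ∈ K.faces) : ContractibleSpace K.Realization := by
  have hv' : K.IsWeight (Finsupp.single v 1) :=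
    ⟨fun a => by rw [Finsupp.single_apply]; split_ifs <;> norm_num, by
      rwa [Finsupp.support_single _ one_ne_zero]⟩
  let p : K.Realization := Realization.ofWeight _ hv'
  have hp : (p : K.Realization).1 = Finsupp.single v 1 := by
    change _⁻¹ • _ = _
    simp
  rw [contractible_iff_id_nullhomotopic]
  refine ⟨p, Realization.homotopic_of_weight
    (fun u x => (1 - u : ℝ) • x + Finsupp.single v (u : ℝ)) (fun u x => ⟨fun a => ?_, ?_⟩)
    (fun s => ?_) (fun x => ⟨1, one_pos, by simp⟩) (fun x => ⟨1, one_pos, by simp [hp]⟩)⟩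
  · have h1 : 0 ≤ Finsupp.single v (u : ℝ) a := by
      rw [Finsupp.single_apply]; split_ifs
      exacts [u.2.1, le_rfl]
    exact add_nonneg (mul_nonneg (sub_nonneg.2 u.2.2) (x.2.1 a)) h1
  · refine mem_faces_of_subset (h _ x.2.2.2) (Finsupp.support_add.trans ?_) ?_
    · refine Finset.union_subset
        (Finsupp.support_smul.trans (Finset.subset_insert _ _)) ?_
      exact Finsupp.support_single_subset.trans (by simp)
    · rw [Finsupp.support_nonempty_iff]
      intro h0
      -- The weights cannot vanish: at `u = 0` they are `x`, and for `u > 0` the coordinate at `v`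
      -- is positive.
      rcases u.2.1.eq_or_lt with hu | hu
      · have : x.1 = 0 := by simpa [← hu] using h0
        exact (K.isRelLowerSet_faces x.2.2.2).1.ne_empty (by simp [this])
      · have := DFunLike.congr_fun h0 v
        have h2 := mul_nonneg (sub_nonneg.2 u.2.2) (x.2.1 v)
        simp at this
        linarith
  · exact .add (.smul (by fun_prop) (Realization.coordContinuous_snd s)) (.single v (by fun_prop))

end PreAbstractSimplicialComplex

/-! ### Depth and truncation -/

namespace PreAbstractSimplicialComplex

variable {α β X : Type*} [TopologicalSpace X]
  {K : PreAbstractSimplicialComplex α} {L : PreAbstractSimplicialComplex β}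

theorem eq_empty_or_mem_faces_of_subset {s t : Finset α} (hs : s = ∅ ∨ s ∈ K.faces)
    (hts : t ⊆ s) : t = ∅ ∨ t ∈ K.faces := by
  rcases t.eq_empty_or_nonempty with h | h
  · exact .inl h
  · rcases hs with rfl | hs
    · exact .inl (Finset.subset_empty.1 hts)
    · exact .inr (mem_faces_of_subset hs hts h)

open Classical in
/-- The depth of `p` in the complement of `K`, computed inside the finite set `T`: the largest
value of the minimum of `p` over a nonempty non-simplex contained in `T`. -/
noncomputable def depthIn (K : PreAbstractSimplicialComplex α) (T : Finset α) (p : α → ℝ) : ℝ :=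
  T.powerset.sup' ⟨∅, Finset.empty_mem_powerset T⟩ fun s =>
    -- The value `0` on `∅` keeps the maximum nonnegative, also when `T` contains no non-simplex.
    if h : s.Nonempty ∧ s ∉ K.faces then s.inf' h.1 p else 0

theorem depthIn_nonneg (T : Finset α) (p : α → ℝ) : 0 ≤ K.depthIn T p := by
  classical
  refine le_trans ?_ (Finset.le_sup' _ (Finset.empty_mem_powerset T))
  rw [dif_neg (by simp)]

open Classical in
-- The vertices of `T` with `p > ε` form the largest subset on which the minimum can exceed `ε`.
-- Simplices are closed under passing to nonempty subsets, so testing this one set suffices.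
theorem depthIn_le_iff {T : Finset α} {p : α → ℝ} {ε : ℝ} (hε : 0 ≤ ε) :
    K.depthIn T p ≤ ε ↔ T.filter (ε < p ·) = ∅ ∨ T.filter (ε < p ·) ∈ K.faces := by
  constructor
  · intro h
    by_contra! hn
    have h1 := (Finset.le_sup' (fun s : Finset α =>
      if h : s.Nonempty ∧ s ∉ K.faces then s.inf' h.1 p else 0)
      (Finset.mem_powerset.2 (Finset.filter_subset (ε < p ·) T))).trans h
    rw [dif_pos hn, Finset.inf'_le_iff] at h1
    obtain ⟨a, ha, hle⟩ := h1
    exact hle.not_gt (Finset.mem_filter.1 ha).2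
  · intro h
    refine Finset.sup'_le _ _ fun s hs => ?_
    split_ifs with hn
    · rw [Finset.inf'_le_iff]
      by_contra! hlt
      refine (eq_empty_or_mem_faces_of_subset h fun a ha => ?_).elim hn.1.ne_empty hn.2
      exact Finset.mem_filter.2 ⟨Finset.mem_powerset.1 hs ha, hlt a ha⟩
    · exact hε

theorem continuous_depthIn (T : Finset α) {p : X → α → ℝ} (hp : ∀ a, Continuous fun x => p x a) :
    Continuous fun x => K.depthIn T (p x) := by
  classical
  refine Continuous.finset_sup'_apply _ fun s _ => ?_
  split_ifs with h
  · exact Continuous.finset_inf'_apply _ fun a _ => hp a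
  · exact continuous_const

/-- The largest value of the minimum of the weights `p` over a non-simplex of `K`. -/
noncomputable def depth (K : PreAbstractSimplicialComplex α) (p : α →₀ ℝ) : ℝ :=
  K.depthIn p.support p

/-- Lets a whole family of weights be measured in one finite set, which makes depth continuous. -/
theorem depth_eq_depthIn {T : Finset α} {p : α →₀ ℝ} (hT : p.support ⊆ T) :
    K.depth p = K.depthIn T p := by
  classical
  refine eq_of_forall_ge_iff fun ε => ?_
  rcases lt_or_ge ε 0 with hε | hε
  · exact iff_of_false (hε.trans_le (depthIn_nonneg _ _)).not_ge
      (hε.trans_le (depthIn_nonneg _ _)).not_ge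
  · have : p.support.filter (ε < p ·) = T.filter (ε < p ·) := by
      ext a
      simp only [Finset.mem_filter]
      exact ⟨fun h => ⟨hT h.1, h.2⟩, fun h =>
        ⟨Finsupp.mem_support_iff.2 (hε.trans_lt h.2).ne', h.2⟩⟩
    rw [depth, depthIn_le_iff hε, depthIn_le_iff hε, this]

theorem depth_nonneg (p : α →₀ ℝ) : 0 ≤ K.depth p := depthIn_nonneg _ _

theorem depth_eq_zero {p : α →₀ ℝ} (h : p.support = ∅ ∨ p.support ∈ K.faces) :
    K.depth p = 0 := by
  classical
  exact (((depthIn_le_iff le_rfl).2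
    (eq_empty_or_mem_faces_of_subset h (Finset.filter_subset _ _)))).antisymm (depth_nonneg p)

theorem depth_smul {c : ℝ} (hc : 0 < c) (p : α →₀ ℝ) : K.depth (c • p) = c * K.depth p := by
  classical
  refine eq_of_forall_ge_iff fun ε => ?_
  rw [← le_div_iff₀' hc]
  rcases lt_or_ge ε 0 with hε | hε
  · exact iff_of_false (hε.trans_le (depth_nonneg _)).not_ge
      ((div_neg_of_neg_of_pos hε hc).trans_le (depth_nonneg _)).not_ge
  · rw [depth, depth, depthIn_le_iff hε, depthIn_le_iff (div_nonneg hε hc.le),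
      Finsupp.support_smul_eq hc.ne']
    have : p.support.filter (ε < (c • p) ·) = p.support.filter (ε / c < p ·) :=
      Finset.filter_congr fun a _ => (div_lt_iff₀' hc).symm
    rw [this]

theorem continuous_depth {w : X → α →₀ ℝ} (hw : Finsupp.CoordContinuous w) :
    Continuous fun x => K.depth (w x) := by
  obtain ⟨⟨T, hT⟩, hc⟩ := hw
  simp only [fun x => depth_eq_depthIn (K := K) (hT x)]
  exact continuous_depthIn T hc

/-- Weights cut off at their depth: the support of the result is empty or a simplex of `K`. -/
noncomputable def truncate (K : PreAbstractSimplicialComplex α) (p : α →₀ ℝ) : α →₀ ℝ :=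
  p.mapRange (fun r => max (r - K.depth p) 0) (by simpa using depth_nonneg p)

theorem truncate_apply (p : α →₀ ℝ) (a : α) : K.truncate p a = max (p a - K.depth p) 0 := rfl

theorem truncate_eq_self {p : α →₀ ℝ} (h : K.depth p = 0) (hp : ∀ a, 0 ≤ p a) :
    K.truncate p = p := by
  ext a
  rw [truncate_apply, h, sub_zero, max_eq_left (hp a)]

theorem truncate_smul {c : ℝ} (hc : 0 < c) (p : α →₀ ℝ) :
    K.truncate (c • p) = c • K.truncate p := by
  ext a
  simp only [truncate_apply, depth_smul hc, Finsupp.smul_apply, smul_eq_mul,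
    mul_max_of_nonneg _ _ hc.le, mul_sub, mul_zero]

/-- The surviving vertices are those strictly above the depth; this is `depthIn_le_iff` with `ε` the
depth itself. -/
theorem support_truncate (p : α →₀ ℝ) :
    (K.truncate p).support = ∅ ∨ (K.truncate p).support ∈ K.faces := by
  classical
  have : (K.truncate p).support = p.support.filter (K.depth p < p ·) := by
    ext a
    rw [Finsupp.mem_support_iff, truncate_apply, Finset.mem_filter, Finsupp.mem_support_iff]
    have := depth_nonneg (K := K) p
    constructor
    · intro h
      have h1 : K.depth p < p a := by
        by_contra! hn
        exact h (max_eq_right (by linarith))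
      exact ⟨(this.trans_lt h1).ne', h1⟩
    · intro h
      exact (lt_max_of_lt_left (sub_pos.2 h.2)).ne'
  rw [this]
  exact (depthIn_le_iff (depth_nonneg p)).1 le_rfl

theorem support_truncate_subset (p : α →₀ ℝ) : (K.truncate p).support ⊆ p.support :=
  Finsupp.support_mapRange

theorem coordContinuous_truncate {w : X → α →₀ ℝ} (hw : Finsupp.CoordContinuous w) :
    Finsupp.CoordContinuous fun x => K.truncate (w x) :=
  ⟨hw.1.imp fun _ h x => (support_truncate_subset _).trans (h x),
    fun a => ((hw.2 a).sub (continuous_depth hw)).max continuous_const⟩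

/-! ### Weights on sums of vertex sets -/

/-- The restriction of weights to the left summand. -/
noncomputable def left (x : α ⊕ β →₀ ℝ) : α →₀ ℝ := x.comapDomain Sum.inl Sum.inl_injective.injOn

/-- The restriction of weights to the right summand. -/
noncomputable def right (x : α ⊕ β →₀ ℝ) : β →₀ ℝ := x.comapDomain Sum.inr Sum.inr_injective.injOn

@[simp] theorem left_apply (x : α ⊕ β →₀ ℝ) (a : α) : left x a = x (.inl a) := rfl

@[simp] theorem right_apply (x : α ⊕ β →₀ ℝ) (b : β) : right x b = x (.inr b) := rfl

theorem toLeft_support (x : α ⊕ β →₀ ℝ) : x.support.toLeft = (left x).support := by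
  ext a; simp

theorem toRight_support (x : α ⊕ β →₀ ℝ) : x.support.toRight = (right x).support := by
  ext a; simp

/-- Weights on a join. -/
theorem isWeight_join_iff {x : α ⊕ β →₀ ℝ} : (K.join L).IsWeight x ↔ x ≠ 0 ∧ (∀ a, 0 ≤ x a) ∧
    ((left x).support = ∅ ∨ (left x).support ∈ K.faces) ∧
    ((right x).support = ∅ ∨ (right x).support ∈ L.faces) := by
  rw [← toLeft_support, ← toRight_support, ← Finsupp.support_nonempty_iff]
  exact ⟨fun h => ⟨h.2.1, h.1, h.2.2⟩, fun h => ⟨h.2.1, h.1, h.2.2⟩⟩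

theorem support_twoPoints {x : Bool →₀ ℝ} :
    (x.support = ∅ ∨ x.support ∈ twoPoints.faces) ↔ x false = 0 ∨ x true = 0 := by
  constructor
  · rintro (h | ⟨b, h⟩)
    · simp [Finsupp.support_eq_empty.1 h]
    · cases b
      · exact .inr (Finsupp.notMem_support_iff.1 (by simp [h]))
      · exact .inl (Finsupp.notMem_support_iff.1 (by simp [h]))
  · intro h
    rcases x.support.eq_empty_or_nonempty with h0 | ⟨b, hb⟩
    · exact .inl h0
    · refine .inr ⟨b, Finset.eq_singleton_iff_unique_mem.2 ⟨hb, fun c hc => ?_⟩⟩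
      rw [Finsupp.mem_support_iff] at hb hc
      cases b <;> cases c <;> simp_all

/-! ### The maps between the union and the suspension, on weights -/

/-- The condition for weights on the join of the full simplices on two vertex sets to have one of
their two components supported on `K` respectively `L`. -/
def IsHalf (K : PreAbstractSimplicialComplex α) (L : PreAbstractSimplicialComplex β)
    (x : α ⊕ β →₀ ℝ) : Prop :=
  ((left x).support = ∅ ∨ (left x).support ∈ K.faces) ∨
    ((right x).support = ∅ ∨ (right x).support ∈ L.faces)

theorem IsHalf.depth_eq_zero {x : α ⊕ β →₀ ℝ} (h : IsHalf K L x) :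
    K.depth (left x) = 0 ∨ L.depth (right x) = 0 :=
  h.imp PreAbstractSimplicialComplex.depth_eq_zero PreAbstractSimplicialComplex.depth_eq_zero

/-- Weights on the two suspension points. -/
noncomputable def poles (r s : ℝ) : Bool →₀ ℝ := Finsupp.single false r + Finsupp.single true s

@[simp] theorem poles_false (r s : ℝ) : poles r s false = r := by simp [poles]

@[simp] theorem poles_true (r s : ℝ) : poles r s true = s := by simp [poles]

/-- Truncate both components and move their depths to the suspension points. -/
noncomputable def spread (K : PreAbstractSimplicialComplex α) (L : PreAbstractSimplicialComplex β)
    (x : α ⊕ β →₀ ℝ) : (α ⊕ β) ⊕ Bool →₀ ℝ :=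
  ((K.truncate (left x)).sumElim (L.truncate (right x))).sumElim
    (poles (K.depth (left x)) (L.depth (right x)))

/-- Move the weights of the suspension points to the vertices `a` and `b`. -/
noncomputable def collapse (a : α) (b : β) (x : (α ⊕ β) ⊕ Bool →₀ ℝ) : α ⊕ β →₀ ℝ :=
  left x + (Finsupp.single (.inl a) (right x false) + Finsupp.single (.inr b) (right x true))

section

variable (a : α) (b : β)

theorem collapse_nonneg {x : (α ⊕ β) ⊕ Bool →₀ ℝ} (hx : ∀ i, 0 ≤ x i) (i : α ⊕ β) :
    0 ≤ collapse a b x i := by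
  classical
  simp only [collapse, Finsupp.add_apply, Finsupp.single_apply]
  have h1 := hx (.inl i)
  have h2 := hx (.inr false)
  have h3 := hx (.inr true)
  simp only [left_apply, right_apply]
  split_ifs <;> positivity

theorem collapse_smul (c : ℝ) (x : (α ⊕ β) ⊕ Bool →₀ ℝ) :
    collapse a b (c • x) = c • collapse a b x := by
  ext i
  classical
  simp only [collapse, Finsupp.add_apply, Finsupp.single_apply, left_apply, right_apply,
    Finsupp.smul_apply, smul_eq_mul]
  split_ifs <;> ring

theorem collapse_eq_zero {x : (α ⊕ β) ⊕ Bool →₀ ℝ} (hx : ∀ i, 0 ≤ x i)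
    (h : collapse a b x = 0) : x = 0 := by
  classical
  have key : ∀ i, x (.inl i) + ((if Sum.inl a = i then x (.inr false) else 0) +
      if Sum.inr b = i then x (.inr true) else 0) = 0 := fun i => by
    simpa [collapse, Finsupp.single_apply] using DFunLike.congr_fun h i
  have hf := hx (.inr false)
  have ht := hx (.inr true)
  ext i
  rw [Finsupp.zero_apply]
  rcases i with i | (_ | _)
  · have h1 := key i
    have h2 := hx (.inl i)
    split_ifs at h1 <;> linarith
  · have h1 := key (.inl a)
    have h2 := hx (.inl (.inl a))
    simp only [if_true, reduceCtorEq, if_false] at h1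
    linarith
  · have h1 := key (.inr b)
    have h2 := hx (.inl (.inr b))
    simp only [if_true, reduceCtorEq, if_false] at h1
    linarith

theorem coordContinuous_collapse {w : X → (α ⊕ β) ⊕ Bool →₀ ℝ} (hw : Finsupp.CoordContinuous w) :
    Finsupp.CoordContinuous fun x => collapse a b (w x) :=
  .add (hw.comapDomain Sum.inl_injective) (.add (.single _ (hw.2 _)) (.single _ (hw.2 _)))

end

theorem coordContinuous_spread {w : X → α ⊕ β →₀ ℝ} (hw : Finsupp.CoordContinuous w) :
    Finsupp.CoordContinuous fun x => spread K L (w x) :=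
  have hl := hw.comapDomain Sum.inl_injective
  have hr := hw.comapDomain Sum.inr_injective
  .sumElim (.sumElim (coordContinuous_truncate hl) (coordContinuous_truncate hr))
    (.add (.single _ (continuous_depth hl)) (.single _ (continuous_depth hr)))

theorem spread_nonneg (x : α ⊕ β →₀ ℝ) (i : (α ⊕ β) ⊕ Bool) : 0 ≤ spread K L x i := by
  rcases i with (i | i) | (_ | _)
  · exact le_max_right _ _
  · exact le_max_right _ _
  · exact (depth_nonneg (K := K) (left x)).trans_eq (poles_false _ _).symm
  · exact (depth_nonneg (K := L) (right x)).trans_eq (poles_true _ _).symm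

@[simp] theorem spread_inr_false (x : α ⊕ β →₀ ℝ) :
    spread K L x (.inr false) = K.depth (left x) := poles_false _ _

@[simp] theorem spread_inr_true (x : α ⊕ β →₀ ℝ) :
    spread K L x (.inr true) = L.depth (right x) := poles_true _ _

/-- Vanishing poles mean vanishing depths, so the truncation has removed nothing. -/
theorem spread_eq_zero {x : α ⊕ β →₀ ℝ} (hx : ∀ i, 0 ≤ x i) (h : spread K L x = 0) : x = 0 := by
  have hK : K.depth (left x) = 0 := by simpa using DFunLike.congr_fun h (.inr false)
  have hL : L.depth (right x) = 0 := by simpa using DFunLike.congr_fun h (.inr true)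
  have h1 := truncate_eq_self hK fun a => hx (.inl a)
  have h2 := truncate_eq_self hL fun a => hx (.inr a)
  ext (a | b)
  · exact (DFunLike.congr_fun h1 a).symm.trans (DFunLike.congr_fun h (.inl (.inl a)))
  · exact (DFunLike.congr_fun h2 b).symm.trans (DFunLike.congr_fun h (.inl (.inr b)))

theorem spread_smul {c : ℝ} (hc : 0 < c) (x : α ⊕ β →₀ ℝ) :
    spread K L (c • x) = c • spread K L x := by
  have hl : left (c • x) = c • left x := Finsupp.ext fun _ => rfl
  have hr : right (c • x) = c • right x := Finsupp.ext fun _ => rfl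
  ext ((i | i) | (_ | _))
  · exact DFunLike.congr_fun (hl ▸ truncate_smul hc (left x) : K.truncate (left (c • x)) = _) i
  · exact DFunLike.congr_fun (hr ▸ truncate_smul hc (right x) : L.truncate (right (c • x)) = _) i
  · simp [hl, depth_smul hc]
  · simp [hr, depth_smul hc]

/-- The components of weights on the suspension of a join. -/
theorem IsWeight.suspension_join {x : (α ⊕ β) ⊕ Bool →₀ ℝ}
    (hx : (K.join L).suspension.IsWeight x) :
    ((left (left x)).support = ∅ ∨ (left (left x)).support ∈ K.faces) ∧
      ((right (left x)).support = ∅ ∨ (right (left x)).support ∈ L.faces) ∧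
      (x (.inr false) = 0 ∨ x (.inr true) = 0) := by
  obtain ⟨-, hn, hl, hp⟩ := isWeight_join_iff.1 hx
  rw [← and_assoc]
  refine ⟨?_, support_twoPoints.1 hp⟩
  rcases hl with h | h
  · rw [Finsupp.support_eq_empty.1 h]
    exact ⟨.inl (Finsupp.support_eq_empty.2 (Finsupp.ext fun _ => rfl)),
      .inl (Finsupp.support_eq_empty.2 (Finsupp.ext fun _ => rfl))⟩
  · exact (isWeight_join_iff.1 ⟨fun i => hn (.inl i), h⟩).2.2

/-- Weights on a suspension of a join, given up to the weights of the suspension points by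
`spread`. -/
theorem isWeight_spread_add {x : α ⊕ β →₀ ℝ} {z : (α ⊕ β) ⊕ Bool →₀ ℝ}
    (h : ∀ i, z (.inl i) = spread K L x (.inl i)) (h0 : z ≠ 0) (hz : ∀ i, 0 ≤ z i)
    (hp : z (.inr false) = 0 ∨ z (.inr true) = 0) :
    (K.join L).suspension.IsWeight z := by
  refine isWeight_join_iff.2 ⟨h0, hz, ?_, support_twoPoints.2 hp⟩
  by_cases hl : left z = 0
  · exact .inl (by simp [hl])
  · refine .inr (isWeight_join_iff.2 ⟨hl, fun i => hz _, ?_, ?_⟩).support_mem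
    · have : left (left z) = K.truncate (left x) := Finsupp.ext fun a => h (.inl a)
      rw [this]
      exact support_truncate _
    · have : right (left z) = L.truncate (right x) := Finsupp.ext fun a => h (.inr a)
      rw [this]
      exact support_truncate _

end PreAbstractSimplicialComplex

/-! ### The union of the two cones is the suspension -/

namespace PreAbstractSimplicialComplex

variable {α β X : Type*} [TopologicalSpace X]
  {K : PreAbstractSimplicialComplex α} {L : PreAbstractSimplicialComplex β}

/-- `U` is the union of the join of `K` with the full simplex on `B` and of the join of the full
simplex on `A` with `L`. -/
structure IsJoinUnion (U : PreAbstractSimplicialComplex (α ⊕ β))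
    (K : PreAbstractSimplicialComplex α) (L : PreAbstractSimplicialComplex β)
    (A : Set α) (B : Set β) : Prop where
  left_subset : ∀ s ∈ K.faces, (s : Set α) ⊆ A
  right_subset : ∀ s ∈ L.faces, (s : Set β) ⊆ B
  mem_faces_iff : ∀ s, s ∈ U.faces ↔ s.Nonempty ∧ ((s.toLeft : Set α) ⊆ A ∧ (s.toRight : Set β) ⊆ B) ∧
    ((s.toLeft = ∅ ∨ s.toLeft ∈ K.faces) ∨ (s.toRight = ∅ ∨ s.toRight ∈ L.faces))

namespace IsJoinUnion

variable {U : PreAbstractSimplicialComplex (α ⊕ β)} {A : Set α} {B : Set β}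
  (hU : IsJoinUnion U K L A B)

include hU

theorem isWeight_iff {x : α ⊕ β →₀ ℝ} : U.IsWeight x ↔ x ≠ 0 ∧ (∀ i, 0 ≤ x i) ∧
    ((∀ a, x (.inl a) ≠ 0 → a ∈ A) ∧ ∀ b, x (.inr b) ≠ 0 → b ∈ B) ∧ IsHalf K L x := by
  have h : x.support ∈ U.faces ↔ x ≠ 0 ∧
      ((∀ a, x (.inl a) ≠ 0 → a ∈ A) ∧ ∀ b, x (.inr b) ≠ 0 → b ∈ B) ∧ IsHalf K L x := by
    rw [hU.mem_faces_iff, toLeft_support, toRight_support, Finsupp.support_nonempty_iff]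
    simp [Set.subset_def, IsHalf]
  exact ⟨fun hx => ⟨(h.1 hx.2).1, hx.1, (h.1 hx.2).2⟩, fun hx => ⟨hx.2.1, h.2 ⟨hx.1, hx.2.2⟩⟩⟩

/-- One pole carries no weight, so the component on that side is unchanged and stays in its own
complex; the other need only stay within `A` or `B`. -/
theorem isWeight_collapse {a : α} {b : β} (ha : a ∈ A) (hb : b ∈ B) {x : (α ⊕ β) ⊕ Bool →₀ ℝ}
    (hx : (K.join L).suspension.IsWeight x) : U.IsWeight (collapse a b x) := by
  classical
  have h0 := (isWeight_join_iff.1 hx).1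
  have hn := hx.nonneg
  have hl' := hx.suspension_join
  have hp := hl'.2.2
  have hA : ∀ i, x (.inl (.inl i)) ≠ 0 → i ∈ A := fun i hi => by
    have hm : i ∈ (left (left x)).support := Finsupp.mem_support_iff.2 hi
    exact hU.left_subset _ (hl'.1.resolve_left (Finset.ne_empty_of_mem hm)) hm
  have hB : ∀ i, x (.inl (.inr i)) ≠ 0 → i ∈ B := fun i hi => by
    have hm : i ∈ (right (left x)).support := Finsupp.mem_support_iff.2 hi
    exact hU.right_subset _ (hl'.2.1.resolve_left (Finset.ne_empty_of_mem hm)) hm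
  refine hU.isWeight_iff.2 ⟨fun h => h0 (collapse_eq_zero a b hn h), collapse_nonneg a b hn,
    ⟨fun i hi => ?_, fun i hi => ?_⟩, hp.imp (fun h => ?_) fun h => ?_⟩
  · by_cases h : a = i
    · exact h ▸ ha
    · exact hA i (by simpa [collapse, Finsupp.single_apply, h] using hi)
  · by_cases h : b = i
    · exact h ▸ hb
    · exact hB i (by simpa [collapse, Finsupp.single_apply, h] using hi)
  · have : left (collapse a b x) = left (left x) := by
      ext i
      simp [collapse, h]
    rw [this]
    exact hl'.1
  · have : right (collapse a b x) = right (left x) := by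
      ext i
      simp [collapse, h]
    rw [this]
    exact hl'.2.1

theorem isWeight_spread {x : α ⊕ β →₀ ℝ} (hx : U.IsWeight x) :
    (K.join L).suspension.IsWeight (spread K L x) := by
  obtain ⟨h0, hn, -, hh⟩ := hU.isWeight_iff.1 hx
  refine isWeight_spread_add (fun _ => rfl) (fun h => h0 (spread_eq_zero hn h))
    (spread_nonneg x) ?_
  rw [spread_inr_false, spread_inr_true]
  exact hh.depth_eq_zero

/-- If one component of `x` is already supported on a simplex, its depth is zero and the round trip
fixes it, so the straight line stays in the same cone. -/
theorem isWeight_add_collapse_spread {a : α} {b : β} (ha : a ∈ A) (hb : b ∈ B)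
    {x : α ⊕ β →₀ ℝ} (hx : U.IsWeight x) (u : I) :
    U.IsWeight ((1 - u : ℝ) • x + (u : ℝ) • collapse a b (spread K L x)) := by
  have hc := hU.isWeight_iff.1 (hU.isWeight_collapse ha hb (hU.isWeight_spread hx))
  obtain ⟨h0, hn, hs, hh⟩ := hU.isWeight_iff.1 hx
  have hu := u.2.1
  have hu' : (0 : ℝ) ≤ 1 - u := sub_nonneg.2 u.2.2
  refine hU.isWeight_iff.2 ⟨fun h => ?_, fun i => add_nonneg (mul_nonneg hu' (hn i))
    (mul_nonneg hu (hc.2.1 i)), ⟨fun i hi => ?_, fun i hi => ?_⟩, hh.imp (fun h => ?_) fun h => ?_⟩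
  · have key : ∀ i, (1 - u : ℝ) * x i = 0 ∧ (u : ℝ) * collapse a b (spread K L x) i = 0 :=
      fun i => (add_eq_zero_iff_of_nonneg (mul_nonneg hu' (hn i))
        (mul_nonneg hu (hc.2.1 i))).1 (DFunLike.congr_fun h i)
    by_cases h1 : (u : ℝ) = 0
    · exact h0 (Finsupp.ext fun i => by simpa [h1] using (key i).1)
    · exact hc.1 (Finsupp.ext fun i => (mul_eq_zero.1 (key i).2).resolve_left h1)
  · by_contra hi'
    have h1 := not_imp_comm.1 (hs.1 i) hi'
    have h2 := not_imp_comm.1 (hc.2.2.1.1 i) hi'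
    exact hi (by simp [h1, h2])
  · by_contra hi'
    have h1 := not_imp_comm.1 (hs.2 i) hi'
    have h2 := not_imp_comm.1 (hc.2.2.1.2 i) hi'
    exact hi (by simp [h1, h2])
  · have hd := depth_eq_zero h
    have ht := truncate_eq_self hd fun i => hn (.inl i)
    refine eq_empty_or_mem_faces_of_subset h fun i hi => ?_
    rw [Finsupp.mem_support_iff] at hi ⊢
    intro h1
    refine hi ?_
    have h2 : spread K L x (.inl (.inl i)) = 0 := (DFunLike.congr_fun ht i).trans h1
    simp only [left_apply] at h1
    simp [collapse, hd, h1, h2]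
  · have hd := depth_eq_zero h
    have ht := truncate_eq_self hd fun i => hn (.inr i)
    refine eq_empty_or_mem_faces_of_subset h fun i hi => ?_
    rw [Finsupp.mem_support_iff] at hi ⊢
    intro h1
    refine hi ?_
    have h2 : spread K L x (.inl (.inr i)) = 0 := (DFunLike.congr_fun ht i).trans h1
    simp only [right_apply] at h1
    simp [collapse, hd, h1, h2]

omit hU in
/-- Part of the weight of the suspension points is moved to `a` and `b` and spread out again; the
rest stays where it is. -/
theorem isWeight_spread_add_poles (a : α) (b : β) {x : (α ⊕ β) ⊕ Bool →₀ ℝ}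
    (hx : (K.join L).suspension.IsWeight x) (u : I) :
    (K.join L).suspension.IsWeight
      (spread K L ((1 - u : ℝ) • left x + (u : ℝ) • collapse a b x) +
        (1 - u : ℝ) • Finsupp.sumElim 0 (right x)) := by
  have h0 := (isWeight_join_iff.1 hx).1
  have hn := hx.nonneg
  have hl' := hx.suspension_join
  have hp := hl'.2.2
  have hu := u.2.1
  have hu' : (0 : ℝ) ≤ 1 - u := sub_nonneg.2 u.2.2
  set y := (1 - u : ℝ) • left x + (u : ℝ) • collapse a b x with hy
  have hy1 : ∀ i, 0 ≤ (1 - u : ℝ) * x (.inl i) := fun i => mul_nonneg hu' (hn _)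
  have hy2 : ∀ i, 0 ≤ (u : ℝ) * collapse a b x i :=
    fun i => mul_nonneg hu (collapse_nonneg a b hn i)
  have hyn : ∀ i, 0 ≤ y i := fun i => add_nonneg (hy1 i) (hy2 i)
  have hr : ∀ i, 0 ≤ ((1 - u : ℝ) • (Finsupp.sumElim 0 (right x) : (α ⊕ β) ⊕ Bool →₀ ℝ)) i := by
    rintro (i | i)
    · simp
    · exact mul_nonneg hu' (hn _)
  refine isWeight_spread_add (x := y) (fun i => by simp) (fun h => ?_)
    (fun i => add_nonneg (spread_nonneg y i) (hr i)) ?_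
  · have key := fun i => (add_eq_zero_iff_of_nonneg (spread_nonneg y i) (hr i)).1
      (DFunLike.congr_fun h i)
    have hy0 := spread_eq_zero hyn (Finsupp.ext fun i => (key i).1)
    have key' := fun i => (add_eq_zero_iff_of_nonneg (hy1 i) (hy2 i)).1 (DFunLike.congr_fun hy0 i)
    by_cases h1 : (u : ℝ) = 0
    · refine h0 (Finsupp.ext ?_)
      rintro (i | i)
      · simpa [h1] using (key' i).1
      · simpa [h1] using (key (.inr i)).2
    · exact h0 (collapse_eq_zero a b hn
        (Finsupp.ext fun i => (mul_eq_zero.1 (key' i).2).resolve_left h1))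
  -- At the pole where `x` vanishes, `collapse` adds nothing on that side, so the component of `y`
  -- has depth zero and the pole stays empty.
  · refine hp.imp (fun h => ?_) fun h => ?_
    · have : K.depth (left y) = 0 := depth_eq_zero (eq_empty_or_mem_faces_of_subset hl'.1 fun i => by
        simp only [Finsupp.mem_support_iff, hy, left_apply]
        exact mt fun h1 => by simp [collapse, h, h1])
      simp [this, h]
    · have : L.depth (right y) = 0 := depth_eq_zero (eq_empty_or_mem_faces_of_subset hl'.2.1 fun i => by
        simp only [Finsupp.mem_support_iff, hy, left_apply, right_apply]
        exact mt fun h1 => by simp [collapse, h, h1])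
      simp [this, h]

omit hU in
theorem spread_left {x : (α ⊕ β) ⊕ Bool →₀ ℝ} (hx : (K.join L).suspension.IsWeight x) :
    spread K L (left x) + Finsupp.sumElim 0 (right x) = x := by
  have hn := hx.nonneg
  have hl' := hx.suspension_join
  have hK := depth_eq_zero hl'.1
  have hL := depth_eq_zero hl'.2.1
  have tK := truncate_eq_self hK fun i => hn (.inl (.inl i))
  have tL := truncate_eq_self hL fun i => hn (.inl (.inr i))
  ext ((i | i) | (_ | _))
  · exact (add_zero _).trans (DFunLike.congr_fun tK i)
  · exact (add_zero _).trans (DFunLike.congr_fun tL i)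
  · simp [hK]
  · simp [hL]

/-- A union of two cones is homotopy equivalent to the suspension of their intersection, for the
cones `K * B` and `A * L`. -/
theorem nonempty_homotopyEquiv (hA : A.Nonempty) (hB : B.Nonempty) :
    Nonempty (U.Realization ≃ₕ (K.join L).suspension.Realization) := by
  obtain ⟨a, ha⟩ := hA
  obtain ⟨b, hb⟩ := hB
  let F : C(U.Realization, (K.join L).suspension.Realization) :=
    Realization.mapOfWeight (spread K L) (fun x => hU.isWeight_spread x.isWeight)
      fun s => coordContinuous_spread (Realization.coordContinuous_closedSimplex s)
  let G : C((K.join L).suspension.Realization, U.Realization) :=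
    Realization.mapOfWeight (collapse a b) (fun x => hU.isWeight_collapse ha hb x.isWeight)
      fun s => coordContinuous_collapse a b (Realization.coordContinuous_closedSimplex s)
  have hF : ∀ x, ∃ c : ℝ, 0 < c ∧ spread K L x.1 = c • (F x).1 := Realization.smul_mapOfWeight
  have hG : ∀ x, ∃ c : ℝ, 0 < c ∧ collapse a b x.1 = c • (G x).1 := Realization.smul_mapOfWeight
  refine ⟨⟨F, G, ?_, ?_⟩⟩
  · refine (Realization.homotopic_of_weight
      (fun u x => (1 - u : ℝ) • x + (u : ℝ) • collapse a b (spread K L x))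
      (fun u x => hU.isWeight_add_collapse_spread ha hb x.isWeight u) (fun s => ?_)
      (fun x => ⟨1, one_pos, by simp⟩) fun x => ?_).symm
    · have h := Realization.coordContinuous_snd (K := U) s
      exact .add (.smul (by fun_prop) h)
        (.smul (by fun_prop) (coordContinuous_collapse a b (coordContinuous_spread h)))
    · obtain ⟨c, hc, h⟩ := hF x
      obtain ⟨d, hd, h'⟩ := hG (F x)
      -- Each of the two maps normalizes once; homogeneity of `collapse` combines the factors.
      refine ⟨c * d, mul_pos hc hd, ?_⟩
      simp [h, collapse_smul, h', mul_smul]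
  · refine (Realization.homotopic_of_weight
      (fun u x => spread K L ((1 - u : ℝ) • left x + (u : ℝ) • collapse a b x) +
        (1 - u : ℝ) • Finsupp.sumElim 0 (right x))
      (fun u x => isWeight_spread_add_poles a b x.isWeight u) (fun s => ?_)
      (fun x => ⟨1, one_pos, by simpa using spread_left x.isWeight⟩) fun x => ?_).symm
    · have h := Realization.coordContinuous_snd (K := (K.join L).suspension) s
      exact .add (coordContinuous_spread (.add
        (.smul (by fun_prop) (h.comapDomain Sum.inl_injective))
        (.smul (by fun_prop) (coordContinuous_collapse a b h))))
        (.smul (by fun_prop) (.sumElim (.const 0) (h.comapDomain Sum.inr_injective)))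
    · obtain ⟨c, hc, h⟩ := hG x
      obtain ⟨d, hd, h'⟩ := hF (G x)
      refine ⟨c * d, mul_pos hc hd, ?_⟩
      simp [h, spread_smul hc, h', mul_smul]

end IsJoinUnion
end PreAbstractSimplicialComplex

/-! ### Application to theta complexes -/

namespace Hypergraph

variable {α β : Type*}

theorem isJoinUnion_theta_disjUnion {H₁ : Hypergraph α} {H₂ : Hypergraph β}
    (h₁ : H₁.edgeSet.Nonempty) (h₂ : H₂.edgeSet.Nonempty) :
    (H₁.disjUnion H₂).theta.IsJoinUnion H₁.theta H₂.theta H₁.vertexSet H₂.vertexSet where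
  left_subset := fun _ ⟨_, _, _, h⟩ => h.trans Set.sdiff_subset
  right_subset := fun _ ⟨_, _, _, h⟩ => h.trans Set.sdiff_subset
  mem_faces_iff s := by
    have hl : ∀ e ∈ H₁.edgeSet, ((s : Set (α ⊕ β)) ⊆ (H₁.disjUnion H₂).vertexSet \ (Sum.inl '' e) ↔
        (s.toLeft : Set α) ⊆ H₁.vertexSet \ e ∧ (s.toRight : Set β) ⊆ H₂.vertexSet) := fun e _ => by
      simp [Set.subset_def, disjUnion]
      grind
    have hr : ∀ e ∈ H₂.edgeSet, ((s : Set (α ⊕ β)) ⊆ (H₁.disjUnion H₂).vertexSet \ (Sum.inr '' e) ↔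
        (s.toLeft : Set α) ⊆ H₁.vertexSet ∧ (s.toRight : Set β) ⊆ H₂.vertexSet \ e) := fun e _ => by
      simp [Set.subset_def, disjUnion]
      grind
    constructor
    · rintro ⟨hs, _, ⟨e, he, rfl⟩ | ⟨e, he, rfl⟩, hse⟩
      · obtain ⟨h, h'⟩ := (hl e he).1 hse
        exact ⟨hs, ⟨h.trans Set.sdiff_subset, h'⟩, .inl <|
          s.toLeft.eq_empty_or_nonempty.imp_right fun h0 => ⟨h0, e, he, h⟩⟩
      · obtain ⟨h, h'⟩ := (hr e he).1 hse
        exact ⟨hs, ⟨h, h'.trans Set.sdiff_subset⟩, .inr <|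
          s.toRight.eq_empty_or_nonempty.imp_right fun h0 => ⟨h0, e, he, h'⟩⟩
    · rintro ⟨hs, ⟨hA, hB⟩, h | h⟩
      · obtain ⟨e, he, h⟩ : ∃ e ∈ H₁.edgeSet, (s.toLeft : Set α) ⊆ H₁.vertexSet \ e := by
          rcases h with h | h
          -- The empty set avoids any hyperedge, so it suffices that one exists.
          · obtain ⟨e, he⟩ := h₁
            exact ⟨e, he, by simp [h]⟩
          · exact h.2
        exact ⟨hs, _, .inl ⟨e, he, rfl⟩, (hl e he).2 ⟨h, hB⟩⟩
      · obtain ⟨e, he, h⟩ : ∃ e ∈ H₂.edgeSet, (s.toRight : Set β) ⊆ H₂.vertexSet \ e := by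
          rcases h with h | h
          · obtain ⟨e, he⟩ := h₂
            exact ⟨e, he, by simp [h]⟩
          · exact h.2
        exact ⟨hs, _, .inr ⟨e, he, rfl⟩, (hr e he).2 ⟨hA, h⟩⟩

theorem contractibleSpace_theta_of_isIsolated {H : Hypergraph α} (hH : H.edgeSet.Nonempty) {v : α}
    (hv : v ∈ H.vertexSet) (hiso : H.IsIsolated v) : ContractibleSpace H.theta.Realization := by
  classical
  refine PreAbstractSimplicialComplex.contractibleSpace_of_cone (v := v) ?_ ?_
  · obtain ⟨e, he⟩ := hH
    exact ⟨Finset.singleton_nonempty v, e, he, by simpa using ⟨hv, hiso e he⟩⟩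
  · rintro s ⟨-, e, he, hs⟩
    refine ⟨Finset.insert_nonempty v s, e, he, ?_⟩
    rw [Finset.coe_insert]
    exact Set.insert_subset ⟨hv, hiso e he⟩ hs

end Hypergraph

theorem mainTheorem6 {α β : Type*} :
    (∀ (H₁ : Hypergraph α) (H₂ : Hypergraph β),
      H₁.vertexSet.Nonempty → H₂.vertexSet.Nonempty →
      H₁.edgeSet.Nonempty → H₂.edgeSet.Nonempty →
      Nonempty ((H₁.disjUnion H₂).theta.Realization ≃ₕ
        (H₁.theta.join H₂.theta).suspension.Realization)) ∧
    (∀ (H : Hypergraph α), H.edgeSet.Nonempty →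
      (∃ v ∈ H.vertexSet, H.IsIsolated v) →
      ContractibleSpace H.theta.Realization) := by
  refine ⟨fun H₁ H₂ hV₁ hV₂ hE₁ hE₂ => ?_, fun H hE ⟨v, hv, hiso⟩ => ?_⟩
  · exact (Hypergraph.isJoinUnion_theta_disjUnion hE₁ hE₂).nonempty_homotopyEquiv hV₁ hV₂
  · exact Hypergraph.contractibleSpace_theta_of_isIsolated hE hv hiso
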